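/- Equip $\mathbb{R}^n$ with the Euclidean norm and standard basis $e_1,\dots,e_n$, and let $\|A\|$ denote the corresponding operator norm of a real $n\times n$ matrix $A$. Call a pair $(c_0,d_0)$ of positive reals a pair of Bourgain–Tzafriri constants if for every $n$ and every $A\in M_{n\times n}(\mathbb{R})$ with $\|Ae_i\|=1$ for all $i$, there is $\sigma\subset\{1,\dots,n\}$ with $|\sigma|\ge d_0n/\|A\|^2$ such that $\big\|\sum_{j\in\sigma}a_jAe_j\big\|\ge c_0\big(\sum_{j\in\sigma}|a_j|^2\big)^{1/2}$ for all scalars $(a_j)_{j\in\sigma}$. Call a family $\{U(t)\}_{t\in\mathbb{R}}$ of subspaces of $\mathbb{R}^n$ continuous if the orthogonal projection onto $U(t)$ depends continuously on $t$. (i) Bourgain–Tzafriri constants exist. (ii) Let $(c_0,d_0)$ be any pair of Bourgain–Tzafriri constants. Let $A:\mathbb{R}\to M_{n\times n}(\mathbb{R})$ be continuous with $\|A(t)e_i\|=1$ for all $t\in\mathbb{R}$ and $1\le i\le n$, let $\Lambda=\sup_{t}\|A(t)\|$, and let $\gamma\in(0,1)$. Then there are an integer $m\ge \dfrac{d_0n}{7\Lambda^2}$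 and a continuous family $\{U(t)\}_{t\in\mathbb{R}}$ of $m$-dimensional subspaces of $\mathbb{R}^n$ such that $\|A(t)v\|\ge\gamma c_0\|v\|$ for every $t\in\mathbb{R}$ and every $v\in U(t)$. (iii) The order $n/\Lambda^2$ is optimal up to a constant: for every $n\ge1$ and $1\le\lambda\le\sqrt n$ there is a continuous $A:\mathbb{R}\to M_{n\times n}(\mathbb{R})$ with $\|A(t)e_i\|=1$ and $\|A(t)\|\le\lambda$ for all $t$ and $i$, such that whenever $c>0$ and $\{U(t)\}_{t\in\mathbb{R}}$ is a continuous family of $m$-dimensional subspaces with $\|A(t)v\|\ge c\|v\|$ for all $t$ and all $v\in U(t)$, one has $m<4n/\lambda^2$. -/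

import Mathlib

/-- The operator on Euclidean space `ℝⁿ` (with the 2-norm) given by a real `n × n` matrix.  Its norm
`‖matOp A‖` is the operator norm of `A`. -/
noncomputable abbrev matOp {n : ℕ} (A : Matrix (Fin n) (Fin n) ℝ) :
    EuclideanSpace ℝ (Fin n) →L[ℝ] EuclideanSpace ℝ (Fin n) :=
  Matrix.toEuclideanCLM (𝕜 := ℝ) A

/-- All columns `A eᵢ` of `A` have Euclidean length one. -/
def HasUnitColumns {n : ℕ} (A : Matrix (Fin n) (Fin n) ℝ) : Prop :=
  ∀ i : Fin n, ‖matOp A (EuclideanSpace.single i (1 : ℝ))‖ = 1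

/-- `(c, d)` is a pair of Bourgain–Tzafriri constants: `c, d > 0`, and for every `n` and every real
`n × n` matrix `A` with unit-length columns there is a set `σ` of at least `d n / ‖A‖²` columns with
`‖∑_{j ∈ σ} aⱼ A eⱼ‖ ≥ c (∑_{j ∈ σ} |aⱼ|²)^{1/2}` for all scalars `aⱼ`. -/
def IsBourgainTzafririPair (c d : ℝ) : Prop :=
  0 < c ∧ 0 < d ∧
    ∀ (n : ℕ) (A : Matrix (Fin n) (Fin n) ℝ), HasUnitColumns A →
      ∃ σ : Finset (Fin n), d * (n : ℝ) / ‖matOp A‖ ^ 2 ≤ (σ.card : ℝ) ∧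
        ∀ a : Fin n → ℝ,
          c * Real.sqrt (∑ j ∈ σ, |a j| ^ 2) ≤
            ‖∑ j ∈ σ, a j • matOp A (EuclideanSpace.single j (1 : ℝ))‖

/-- A family of subspaces of `ℝⁿ` indexed by `ℝ` is continuous if the orthogonal projection onto
`U t` depends continuously on `t`. -/
def IsContinuousFamily {n : ℕ} (U : ℝ → Submodule ℝ (EuclideanSpace ℝ (Fin n))) : Prop :=
  Continuous fun t : ℝ => (U t).starProjection

/-! (i) is a barrier argument. Let `S` be the frame operator of the columns chosen so far. While
their Riesz bound exceeds `b`, the resolvent `R = (b - S)⁻¹` exists, and the potential `∑ ⟪w j, R (w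
j)⟫` over all columns measures the room left. Lowering `b` raises the potential, adding a column
lowers it, and an averaging argument (`exists_barrier_step`) finds a column whose cost is covered by
the gain.

(ii) asks for a path of isometric frames. A good frame at time `a` occupies `m` dimensions, and its
image under `T* T` at most `m` more. A good subspace of dimension `3m` at a nearby time `b`
therefore contains an `m`-frame orthogonal to both. Rotating one frame into the other keeps the
lower bound up to `2ε`, and the new frame has the full constant `c` for its own operator, so errors
never accumulate (`CanExtendFrames.trans`).

(iii) needs only a constant path: a matrix of repeated basis vectors has small rank, and a lower
bound on `U` forces injectivity there. -/

/-! ### Restricted invertibility by a barrier argument -/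

section RestrictedInvertibility

open scoped RealInnerProductSpace

variable {κ E : Type*} [NormedAddCommGroup E] [InnerProductSpace ℝ E]

/-- The frame operator `x ↦ ∑ j ∈ σ, ⟪w j, x⟫ w j` of the vectors `w j`, `j ∈ σ`. -/
noncomputable def partialFrame (w : κ → E) (σ : Finset κ) : E →ₗ[ℝ] E :=
  ∑ j ∈ σ, ((innerₛₗ ℝ (w j)).smulRight (w j))

theorem partialFrame_apply (w : κ → E) (σ : Finset κ) (x : E) :
    partialFrame w σ x = ∑ j ∈ σ, ⟪w j, x⟫ • w j := by
  simp [partialFrame]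

theorem inner_partialFrame (w : κ → E) (σ : Finset κ) (x y : E) :
    ⟪x, partialFrame w σ y⟫ = ∑ j ∈ σ, ⟪w j, x⟫ * ⟪w j, y⟫ := by
  rw [partialFrame_apply, inner_sum]
  refine Finset.sum_congr rfl fun j _ => ?_
  rw [inner_smul_right, real_inner_comm (w j) x, mul_comm]

/-- The vectors `w j`, `j ∈ σ`, satisfy a strict lower Riesz bound with constant `b`. -/
def StrictLowerRiesz (w : κ → E) (σ : Finset κ) (b : ℝ) : Prop :=
  ∀ a : κ → ℝ, (∃ j ∈ σ, a j ≠ 0) → b * ∑ j ∈ σ, a j ^ 2 < ‖∑ j ∈ σ, a j • w j‖ ^ 2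

/-- `R` is a right inverse of `b - partialFrame w σ`. -/
def IsFrameResolvent (w : κ → E) (σ : Finset κ) (b : ℝ) (R : E →ₗ[ℝ] E) : Prop :=
  ∀ x, b • R x - partialFrame w σ (R x) = x

theorem StrictLowerRiesz.le {w : κ → E} {σ : Finset κ} {b : ℝ} (h : StrictLowerRiesz w σ b)
    (a : κ → ℝ) : b * ∑ j ∈ σ, a j ^ 2 ≤ ‖∑ j ∈ σ, a j • w j‖ ^ 2 := by
  by_cases ha : ∃ j ∈ σ, a j ≠ 0
  · exact (h a ha).le
  · push Not at ha
    rw [Finset.sum_eq_zero fun j hj => by rw [ha j hj]; simp]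
    simp only [mul_zero]
    positivity

theorem StrictLowerRiesz.mono {w : κ → E} {σ : Finset κ} {b b' : ℝ} (h : StrictLowerRiesz w σ b)
    (hb : b' ≤ b) : StrictLowerRiesz w σ b' := fun a ha =>
  (mul_le_mul_of_nonneg_right hb (Finset.sum_nonneg fun _ _ => sq_nonneg _)).trans_lt (h a ha)

/-- An eigenvector `x` of the frame operator for `b` would give equality in the Riesz bound at the
coefficients `⟪w j, x⟫`, against strictness. -/
theorem StrictLowerRiesz.injective {w : κ → E} {σ : Finset κ} {b : ℝ} (hb : 0 < b)
    (h : StrictLowerRiesz w σ b) :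
    Function.Injective (b • (LinearMap.id : E →ₗ[ℝ] E) - partialFrame w σ) := by
  rw [injective_iff_map_eq_zero]
  intro x hx
  have hx' : b • x = ∑ j ∈ σ, ⟪w j, x⟫ • w j := by
    rw [← partialFrame_apply]
    simpa [sub_eq_zero] using hx
  by_cases ha : ∃ j ∈ σ, ⟪w j, x⟫ ≠ 0
  · have h1 := h (fun j => ⟪w j, x⟫) ha
    have h2 : ‖∑ j ∈ σ, ⟪w j, x⟫ • w j‖ ^ 2 = b * ∑ j ∈ σ, ⟪w j, x⟫ ^ 2 := by
      rw [← real_inner_self_eq_norm_sq]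
      nth_rw 1 [← hx']
      rw [← partialFrame_apply, inner_smul_left, inner_partialFrame]
      simp [sq]
    linarith
  · push Not at ha
    rw [Finset.sum_eq_zero fun j hj => by rw [ha j hj]; simp] at hx'
    exact (smul_eq_zero.mp hx').resolve_left hb.ne'

theorem StrictLowerRiesz.exists_resolvent [FiniteDimensional ℝ E] {w : κ → E} {σ : Finset κ}
    {b : ℝ} (hb : 0 < b) (h : StrictLowerRiesz w σ b) : ∃ R, IsFrameResolvent w σ b R := by
  refine ⟨(LinearEquiv.ofInjectiveEndo _ (h.injective hb)).symm.toLinearMap, fun x => ?_⟩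
  exact (LinearEquiv.ofInjectiveEndo _ (h.injective hb)).apply_symm_apply x

namespace IsFrameResolvent

variable {w : κ → E} {σ : Finset κ} {b : ℝ} {R : E →ₗ[ℝ] E}

theorem smul_apply (h : IsFrameResolvent w σ b R) (x : E) :
    b • R x = x + partialFrame w σ (R x) := by
  rw [← sub_eq_iff_eq_add, h]

theorem inner_left (h : IsFrameResolvent w σ b R) (x y : E) : ⟪R x, y⟫ = ⟪x, R y⟫ := by
  conv_lhs => rw [← h y]
  conv_rhs => rw [← h x]
  rw [inner_sub_left, inner_sub_right, inner_smul_left, inner_smul_right, inner_partialFrame,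
    real_inner_comm _ (partialFrame w σ (R x)), inner_partialFrame]
  simp [mul_comm]

theorem inner_self (h : IsFrameResolvent w σ b R) (x : E) :
    ⟪x, R x⟫ = b * ‖R x‖ ^ 2 - ∑ j ∈ σ, ⟪w j, R x⟫ ^ 2 := by
  conv_lhs => rw [← h x]
  rw [inner_sub_left, inner_smul_left, real_inner_comm _ (partialFrame w σ (R (_))),
    inner_partialFrame, h x, real_inner_self_eq_norm_sq]
  simp [sq]

theorem apply_of_eq (h : IsFrameResolvent w σ b R) (hb : 0 < b) (hr : StrictLowerRiesz w σ b)
    {x y : E} (hxy : b • y - partialFrame w σ y = x) : R x = y := by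
  apply hr.injective hb
  simpa [hxy] using h x

/-- The Riesz bound gives `S² ≥ bS`, hence `(b - S)² ≥ b(b - S)`; evaluate at `R x`. -/
theorem inner_self_le (h : IsFrameResolvent w σ b R) (hb : 0 < b) (hr : StrictLowerRiesz w σ b)
    (x : E) : ⟪x, R x⟫ ≤ ‖x‖ ^ 2 / b := by
  have h1 := hr.le fun j => ⟪w j, R x⟫
  rw [← partialFrame_apply] at h1
  have h2 : ‖x‖ ^ 2 = b ^ 2 * ‖R x‖ ^ 2 - 2 * b * (∑ j ∈ σ, ⟪w j, R x⟫ ^ 2)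
      + ‖partialFrame w σ (R x)‖ ^ 2 := by
    conv_lhs => rw [← h x]
    rw [norm_sub_sq_real, inner_smul_left, inner_partialFrame, norm_smul, mul_pow,
      Real.norm_eq_abs, sq_abs]
    simp [sq]
    ring
  rw [le_div_iff₀ hb, h.inner_self, h2]
  linarith

/-- Lowering the barrier from `b` to `b - δ`. -/
theorem inner_shift (h : IsFrameResolvent w σ b R) {R' : E →ₗ[ℝ] E} {δ : ℝ} (hb : 0 < b)
    (hδ : 0 ≤ δ) (h2 : 2 * δ ≤ b) (hr : StrictLowerRiesz w σ b)
    (h' : IsFrameResolvent w σ (b - δ) R') (x : E) :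
    ⟪x, R x⟫ + δ / 2 * ‖R' x‖ ^ 2 ≤ ⟪x, R' x⟫ := by
  -- The resolvent identity; applied twice, it leaves a second-order term that `2δ ≤ b` makes at
  -- most half of the first-order one.
  have e1 : R x = R' x - δ • R (R' x) := by
    have : R (x + δ • R' x) = R' x := by
      apply h.apply_of_eq hb hr
      have := h' x
      rw [sub_smul, sub_right_comm, sub_eq_iff_eq_add] at this
      exact this
    rw [map_add, map_smul] at this
    exact eq_sub_of_add_eq this
  have e2 : ⟪x, R x⟫ = ⟪x, R' x⟫ - δ * ⟪R x, R' x⟫ := by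
    rw [h.inner_left]
    nth_rw 1 [e1]
    rw [inner_sub_right, inner_smul_right]
  have e3 : ⟪R x, R' x⟫ = ‖R' x‖ ^ 2 - δ * ⟪R' x, R (R' x)⟫ := by
    rw [e1, inner_sub_left, inner_smul_left, real_inner_self_eq_norm_sq, h.inner_left]
    simp
  have e4 : δ * ⟪R' x, R (R' x)⟫ ≤ ‖R' x‖ ^ 2 / 2 := by
    have := mul_le_mul_of_nonneg_left (h.inner_self_le hb hr (R' x)) hδ
    refine this.trans ?_
    rw [mul_div_assoc', div_le_div_iff₀ hb two_pos]
    nlinarith [sq_nonneg ‖R' x‖]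
  nlinarith

variable [DecidableEq κ]

/-- On the span of the chosen vectors `S` exceeds `b`, so the resolvent is negative there. Hence a
column with positive form is a new one. -/
theorem inner_self_le_of_mem (h : IsFrameResolvent w σ b R) (hb : 0 < b)
    (hr : StrictLowerRiesz w σ b) {i : κ} (hi : i ∈ σ) : ⟪w i, R (w i)⟫ ≤ 0 := by
  set y : κ → ℝ := fun j => ⟪w j, R (w i)⟫ with hy
  set a : κ → ℝ := fun j => (if j = i then 1 else 0) + y j with ha
  have e1 : ∑ j ∈ σ, a j • w j = b • R (w i) := by
    rw [h.smul_apply, partialFrame_apply]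
    simp [ha, add_smul, Finset.sum_add_distrib, ite_smul, hi, hy]
  have e2 := hr.le a
  have e3 : ‖∑ j ∈ σ, a j • w j‖ ^ 2 = b * ∑ j ∈ σ, a j * y j := by
    rw [← real_inner_self_eq_norm_sq]
    nth_rw 1 [e1]
    rw [inner_smul_left, inner_sum]
    simp only [inner_smul_right, real_inner_comm, hy]
    simp
  have e4 : ∑ j ∈ σ, a j * y j = ∑ j ∈ σ, a j ^ 2 - a i := by
    have : ∀ j, a j * y j = a j ^ 2 - if j = i then a j else 0 := by
      intro j
      simp only [ha]
      split_ifs <;> ring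
    simp [this, Finset.sum_sub_distrib, hi]
  rw [e3, e4] at e2
  have e5 : a i ≤ 0 := by nlinarith
  simp only [ha, if_true] at e5
  linarith

/-- Adding a vector on which the resolvent form exceeds one keeps the lower Riesz bound. -/
theorem strictLowerRiesz_insert (h : IsFrameResolvent w σ b R) (hb : 0 < b)
    (hr : StrictLowerRiesz w σ b) {i : κ} (hi : i ∉ σ) (hq : 1 < ⟪w i, R (w i)⟫) :
    StrictLowerRiesz w (insert i σ) b := by
  intro a ha
  by_cases hs : a i = 0
  · simp only [Finset.sum_insert hi, hs]
    simp only [zero_smul, zero_add, ne_eq, OfNat.ofNat_ne_zero, not_false_eq_true, zero_pow]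
    apply hr
    obtain ⟨j, hj, hj'⟩ := ha
    rcases Finset.mem_insert.mp hj with rfl | hj
    · exact absurd hs hj'
    · exact ⟨j, hj, hj'⟩
  set s := a i
  set x := R (w i) with hx
  set y : κ → ℝ := fun j => ⟪w j, x⟫ with hy
  have e1 := hr.le fun j => a j - s * y j
  -- Completing the square: with `w i = b x - S x`, the old bound at the shifted coefficients leaves
  -- the surplus `s² b (⟪w i, x⟫ - 1) > 0`.
  have e2 : ∑ j ∈ insert i σ, a j • w j = ∑ j ∈ σ, (a j - s * y j) • w j + (s * b) • x := by
    rw [Finset.sum_insert hi, mul_smul, h.smul_apply, partialFrame_apply]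
    simp only [sub_smul, Finset.sum_sub_distrib, smul_add, mul_smul, ← Finset.smul_sum, hy, s]
    abel
  have e3 : ⟪∑ j ∈ σ, (a j - s * y j) • w j, x⟫ = ∑ j ∈ σ, (a j - s * y j) * y j := by
    rw [sum_inner]
    exact Finset.sum_congr rfl fun j _ => by rw [inner_smul_left]; rfl
  have e4 : ∑ j ∈ σ, a j ^ 2 = ∑ j ∈ σ, (a j - s * y j) ^ 2 +
      2 * s * ∑ j ∈ σ, (a j - s * y j) * y j + s ^ 2 * ∑ j ∈ σ, y j ^ 2 := by
    simp only [Finset.mul_sum, ← Finset.sum_add_distrib]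
    exact Finset.sum_congr rfl fun j _ => by ring
  rw [h.inner_self] at hq
  rw [e2, norm_add_sq_real, inner_smul_right, e3, Finset.sum_insert hi, e4, norm_smul, mul_pow,
    Real.norm_eq_abs, sq_abs]
  have e5 : 0 < s ^ 2 * b * (b * ‖x‖ ^ 2 - ∑ j ∈ σ, y j ^ 2 - 1) := by
    apply mul_pos
    · positivity
    · linarith
  nlinarith

/-- The Sherman–Morrison formula. -/
theorem insert (h : IsFrameResolvent w σ b R) {i : κ} (hi : i ∉ σ) (hq : 1 < ⟪w i, R (w i)⟫) :
    IsFrameResolvent w (insert i σ) b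
      (R - (⟪w i, R (w i)⟫ - 1)⁻¹ • ((innerₛₗ ℝ (w i)).comp R).smulRight (R (w i))) := by
  intro z
  set q := ⟪w i, R (w i)⟫
  have e0 : ∀ x, partialFrame w (Insert.insert i σ) x = ⟪w i, x⟫ • w i + partialFrame w σ x := by
    intro x
    rw [partialFrame_apply, Finset.sum_insert hi, partialFrame_apply]
  simp only [LinearMap.sub_apply, LinearMap.smul_apply, LinearMap.smulRight_apply,
    LinearMap.comp_apply, innerₛₗ_apply_apply, smul_smul]
  set c := (q - 1)⁻¹ * ⟪w i, R z⟫ with hc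
  have e1 := h.smul_apply z
  have e2 := h.smul_apply (w i)
  rw [e0, smul_sub, smul_comm b c, e1, e2, map_sub, map_smul, inner_sub_right, inner_smul_right]
  have e3 : ⟪w i, R z⟫ = c * (q - 1) := by
    rw [hc]; field_simp [(sub_pos.mpr hq).ne']
  have e4 : ⟪w i, R z⟫ - c * ⟪w i, R (w i)⟫ = - c := by
    rw [e3]; ring
  rw [e4]
  module

end IsFrameResolvent

variable [Fintype κ] [DecidableEq κ] [FiniteDimensional ℝ E]

/-- One step of the barrier argument. -/
theorem exists_barrier_step {w : κ → E} {L b δ : ℝ} {σ : Finset κ} {R : E →ₗ[ℝ] E}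
    (hL : ∀ x, ∑ j, ⟪w j, x⟫ ^ 2 ≤ L * ‖x‖ ^ 2) (hκ : 0 < Fintype.card κ)
    (hδ : 0 < δ) (hδL : 2 * L ≤ δ * Fintype.card κ) (hb : 2 * δ ≤ b)
    (hr : StrictLowerRiesz w σ b) (h : IsFrameResolvent w σ b R)
    (hΦ : 2 * (Fintype.card κ : ℝ) ≤ ∑ j, ⟪w j, R (w j)⟫) :
    ∃ i ∉ σ, ∃ R' : E →ₗ[ℝ] E, StrictLowerRiesz w (insert i σ) (b - δ) ∧
      IsFrameResolvent w (insert i σ) (b - δ) R' ∧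
      2 * (Fintype.card κ : ℝ) ≤ ∑ j, ⟪w j, R' (w j)⟫ := by
  set N : ℝ := (Fintype.card κ : ℝ) with hN
  have hN0 : 0 < N := Nat.cast_pos.mpr hκ
  have hb0 : 0 < b := by linarith
  have hb0' : 0 < b - δ := by linarith
  have hr' := hr.mono (sub_le_self b hδ.le)
  obtain ⟨R', h'⟩ := hr'.exists_resolvent hb0'
  set q : κ → ℝ := fun i => ⟪w i, R' (w i)⟫ with hq
  set T := ∑ i, ‖R' (w i)‖ ^ 2 with hT
  set D := (∑ i, q i) - ∑ i, ⟪w i, R (w i)⟫ with hD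
  have hDT : δ / 2 * T ≤ D := by
    have : ∑ i, (⟪w i, R (w i)⟫ + δ / 2 * ‖R' (w i)‖ ^ 2) ≤ ∑ i, q i :=
      Finset.sum_le_sum fun i _ => h.inner_shift hb0 hδ.le hb hr h' (w i)
    rw [Finset.sum_add_distrib, ← Finset.mul_sum] at this
    linarith
  have hT0 : 0 ≤ T := Finset.sum_nonneg fun _ _ => by positivity
  have hD0 : 0 ≤ D := le_trans (by positivity) hDT
  have hqN : N ≤ ∑ i, (q i - 1) := by
    rw [Finset.sum_sub_distrib]
    simp only [Finset.sum_const, Finset.card_univ, nsmul_eq_mul, mul_one]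
    linarith
  -- Averaging: the left sides sum to `L T ≤ δ N T / 2 ≤ D N`, while the `q i - 1` sum to at least
  -- `N`. The Sherman–Morrison loss for such an `i` is at most the gain `D`.
  obtain ⟨i, hi1, hi2⟩ : ∃ i, 1 < q i ∧ L * ‖R' (w i)‖ ^ 2 ≤ D * (q i - 1) := by
    by_contra! hcon
    have hle : ∀ i ∈ Finset.univ, D * (q i - 1) ≤ L * ‖R' (w i)‖ ^ 2 := by
      intro i _
      rcases lt_or_ge 1 (q i) with h1 | h1
      · exact (hcon i h1).le
      · refine le_trans (mul_nonpos_of_nonneg_of_nonpos hD0 (by linarith)) ?_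
        exact le_trans (Finset.sum_nonneg fun _ _ => sq_nonneg _) (hL _)
    obtain ⟨i, _, hi⟩ : ∃ i ∈ Finset.univ, 0 < q i - 1 :=
      Finset.exists_lt_of_sum_lt (by simpa using hN0.trans_le hqN)
    have := Finset.sum_lt_sum hle ⟨i, Finset.mem_univ i, hcon i (by linarith)⟩
    rw [← Finset.mul_sum, ← Finset.mul_sum] at this
    have h3 : D * N ≤ D * ∑ i, (q i - 1) := mul_le_mul_of_nonneg_left hqN hD0
    have h4 : δ / 2 * T * N ≤ D * N := mul_le_mul_of_nonneg_right hDT hN0.le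
    have h5 : 2 * L * T ≤ δ * N * T := mul_le_mul_of_nonneg_right hδL hT0
    linarith
  have hiσ : i ∉ σ := fun hmem => by
    have := h'.inner_self_le_of_mem hb0' hr' hmem
    change q i ≤ 0 at this
    linarith
  refine ⟨i, hiσ, _, h'.strictLowerRiesz_insert hb0' hr' hiσ hi1, h'.insert hiσ hi1, ?_⟩
  have e1 : ∀ j, ⟪w j, R' (w i)⟫ = ⟪w i, R' (w j)⟫ := fun j => by
    rw [← h'.inner_left, real_inner_comm]
  simp only [LinearMap.sub_apply, LinearMap.smul_apply, LinearMap.smulRight_apply,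
    LinearMap.comp_apply, innerₛₗ_apply_apply, inner_sub_right, inner_smul_right,
    Finset.sum_sub_distrib]
  have e2 : ∑ j, (⟪w i, R' (w i)⟫ - 1)⁻¹ * (⟪w i, R' (w j)⟫ * ⟪w j, R' (w i)⟫) ≤ D := by
    rw [← Finset.mul_sum, inv_mul_le_iff₀ (by linarith), mul_comm]
    refine le_trans ?_ hi2
    refine le_trans (le_of_eq ?_) (hL _)
    exact Finset.sum_congr rfl fun j _ => by rw [← e1, sq]
  linarith

/-- Restricted invertibility for unit vectors with upper frame bound `L`. -/
theorem exists_lowerRiesz_card_eq {w : κ → E} {L : ℝ} (hL0 : 0 < L)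
    (hw : ∀ i, ‖w i‖ = 1) (hL : ∀ x, ∑ j, ⟪w j, x⟫ ^ 2 ≤ L * ‖x‖ ^ 2) (hκ : 0 < Fintype.card κ)
    (k : ℕ) (hk : 8 * L * k ≤ Fintype.card κ) :
    ∃ σ : Finset κ, σ.card = k ∧ StrictLowerRiesz w σ (1 / 4) := by
  set N : ℝ := (Fintype.card κ : ℝ) with hN
  have hN0 : 0 < N := Nat.cast_pos.mpr hκ
  set δ := 2 * L / N with hδ
  have hδ0 : 0 < δ := by positivity
  have hδN : δ * N = 2 * L := by rw [hδ]; field_simp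
  have hstep : ∀ k : ℕ, 4 * k * δ ≤ 1 → ∃ σ : Finset κ, σ.card = k ∧
      ∃ R : E →ₗ[ℝ] E, StrictLowerRiesz w σ (1 / 2 - k * δ) ∧
      IsFrameResolvent w σ (1 / 2 - k * δ) R ∧ 2 * N ≤ ∑ j, ⟪w j, R (w j)⟫ := by
    intro k
    induction k with
    | zero =>
      intro _
      -- Starting at `b = 1/2` with no vectors, the potential is exactly `2N`.
      refine ⟨∅, rfl, (2 : ℝ) • LinearMap.id, fun a ha => by simp at ha, fun x => ?_, ?_⟩
      · simp [partialFrame_apply, smul_smul]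
      · simp [inner_smul_right, hw, hN, mul_comm]
    | succ k ih =>
      intro hk
      push_cast at hk
      obtain ⟨σ, hσ, R, h1, h2, h3⟩ := ih (by nlinarith)
      obtain ⟨i, hi, R', h1', h2', h3'⟩ := exists_barrier_step hL hκ hδ0 hδN.ge
        (by nlinarith [(Nat.cast_nonneg k : (0 : ℝ) ≤ k)]) h1 h2 h3
      have e : (1 / 2 - (k : ℝ) * δ - δ) = 1 / 2 - ((k + 1 : ℕ) : ℝ) * δ := by push_cast; ring
      rw [e] at h1' h2'
      exact ⟨insert i σ, by rw [Finset.card_insert_of_notMem hi, hσ], R', h1', h2', h3'⟩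
  have hkδ : 4 * k * δ ≤ 1 := by
    rw [hδ, mul_div_assoc', div_le_one hN0]
    linarith
  obtain ⟨σ, hσ, -, h1, -⟩ := hstep k hkδ
  exact ⟨σ, hσ, h1.mono (by linarith)⟩

end RestrictedInvertibility

theorem one_le_norm_matOp {n : ℕ} (hn : 0 < n) {A : Matrix (Fin n) (Fin n) ℝ}
    (hA : HasUnitColumns A) : 1 ≤ ‖matOp A‖ := by
  have := (matOp A).le_opNorm (EuclideanSpace.single ⟨0, hn⟩ (1 : ℝ))
  rw [hA] at this
  simpa using this

theorem exists_isBourgainTzafririPair : IsBourgainTzafririPair (1 / 2) (1 / 16) := by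
  refine ⟨by norm_num, by norm_num, fun n A hA => ?_⟩
  rcases Nat.eq_zero_or_pos n with rfl | hn
  · exact ⟨∅, by simp, by simp⟩
  set w : Fin n → EuclideanSpace ℝ (Fin n) :=
    fun i => matOp A (EuclideanSpace.single i (1 : ℝ)) with hw
  have hw1 : ∀ i, ‖w i‖ = 1 := hA
  set L := ‖matOp A‖ ^ 2 with hL
  have hn1 := one_le_norm_matOp hn hA
  have hL0 : 0 < L := by positivity
  have hframe : ∀ x, ∑ j, inner ℝ (w j) x ^ 2 ≤ L * ‖x‖ ^ 2 := by
    intro x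
    have e : ∀ j, inner ℝ (w j) x = ContinuousLinearMap.adjoint (matOp A) x j := by
      intro j
      rw [hw]
      simp only
      rw [← ContinuousLinearMap.adjoint_inner_right, EuclideanSpace.inner_single_left]
      simp
    have h1 := (ContinuousLinearMap.adjoint (matOp A)).le_opNorm x
    rw [LinearIsometryEquiv.norm_map] at h1
    calc ∑ j, inner ℝ (w j) x ^ 2 = ‖ContinuousLinearMap.adjoint (matOp A) x‖ ^ 2 := by
          rw [EuclideanSpace.real_norm_sq_eq]
          exact Finset.sum_congr rfl fun j _ => by rw [e]
      _ ≤ (‖matOp A‖ * ‖x‖) ^ 2 := by gcongr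
      _ = L * ‖x‖ ^ 2 := by rw [mul_pow]
  have key : ∃ σ : Finset (Fin n), 1 / 16 * (n : ℝ) / L ≤ (σ.card : ℝ) ∧
      ∀ a : Fin n → ℝ, 1 / 4 * ∑ j ∈ σ, a j ^ 2 ≤ ‖∑ j ∈ σ, a j • w j‖ ^ 2 := by
    -- Below `8L` one column suffices; above it, rounding down costs at most a factor `2`, whence
    -- `1/16`.
    rcases lt_or_ge (n : ℝ) (8 * L) with hlt | hge
    · refine ⟨{⟨0, hn⟩}, ?_, fun a => ?_⟩
      · rw [div_le_iff₀ hL0]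
        simp
        linarith
      · simp only [Finset.sum_singleton, norm_smul, hw1, Real.norm_eq_abs, mul_one, sq_abs]
        nlinarith [sq_nonneg (a ⟨0, hn⟩)]
    · have hx : 1 ≤ (n : ℝ) / (8 * L) := by rwa [one_le_div (by positivity)]
      obtain ⟨σ, hσ, h⟩ := exists_lowerRiesz_card_eq hL0 hw1 hframe (by simpa using hn)
        ⌊(n : ℝ) / (8 * L)⌋₊ (by
          have := Nat.floor_le (zero_le_one.trans hx)
          rw [le_div_iff₀ (by positivity)] at this
          simpa [mul_comm] using this)
      refine ⟨σ, ?_, h.le⟩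
      rw [hσ]
      have h1 : (1 : ℝ) ≤ (⌊(n : ℝ) / (8 * L)⌋₊ : ℝ) := by
        exact_mod_cast Nat.one_le_floor_iff _ |>.mpr hx
      have h2 := Nat.lt_floor_add_one ((n : ℝ) / (8 * L))
      have h3 : 1 / 16 * (n : ℝ) / L = (n : ℝ) / (8 * L) / 2 := by field_simp; norm_num
      rw [h3]
      linarith
  obtain ⟨σ, hσ, h⟩ := key
  refine ⟨σ, hσ, fun a => ?_⟩
  refine (sq_le_sq₀ (by positivity) (norm_nonneg _)).mp ?_
  rw [mul_pow, Real.sq_sqrt (Finset.sum_nonneg fun _ _ => sq_nonneg _)]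
  simp only [sq_abs]
  refine le_trans (le_of_eq ?_) (h a)
  norm_num

/-! ### Optimality: matrices with repeated columns -/

theorem matOp_apply {n : ℕ} (A : Matrix (Fin n) (Fin n) ℝ) (x : EuclideanSpace ℝ (Fin n))
    (i : Fin n) : matOp A x i = ∑ j, A i j * x j := by
  simp [matOp, Matrix.mulVec, dotProduct]

/-- The matrix whose columns come in consecutive blocks of `f` equal standard basis vectors. -/
def blockMatrix (n f : ℕ) : Matrix (Fin n) (Fin n) ℝ :=
  fun i j => if (i : ℕ) = j / f then 1 else 0

theorem hasUnitColumns_blockMatrix (n f : ℕ) : HasUnitColumns (blockMatrix n f) := by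
  intro j
  have : matOp (blockMatrix n f) (EuclideanSpace.single j (1 : ℝ)) =
      EuclideanSpace.single ⟨j / f, (Nat.div_le_self _ _).trans_lt j.2⟩ (1 : ℝ) := by
    ext i
    rw [matOp_apply, Finset.sum_eq_single j (fun k _ hk => by simp [hk]) (by simp)]
    simp [blockMatrix, Fin.ext_iff]
  rw [this]
  simp

/-- Rows have disjoint supports of size at most `f`; apply Cauchy–Schwarz in each. -/
theorem norm_matOp_blockMatrix_le (n : ℕ) {f : ℕ} (hf : 0 < f) :
    ‖matOp (blockMatrix n f)‖ ≤ Real.sqrt f := by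
  refine ContinuousLinearMap.opNorm_le_bound _ (Real.sqrt_nonneg _) fun x => ?_
  refine (sq_le_sq₀ (norm_nonneg _) (by positivity)).mp ?_
  rw [mul_pow, Real.sq_sqrt (Nat.cast_nonneg f), EuclideanSpace.real_norm_sq_eq,
    EuclideanSpace.real_norm_sq_eq]
  set g : Fin n → Fin n := fun j => ⟨j / f, (Nat.div_le_self _ _).trans_lt j.2⟩ with hg
  have e1 : ∀ i, matOp (blockMatrix n f) x i = ∑ j with g j = i, x j := by
    intro i
    rw [matOp_apply, Finset.sum_filter]
    refine Finset.sum_congr rfl fun j _ => ?_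
    simp [blockMatrix, hg, Fin.ext_iff, eq_comm]
  have hcard : ∀ i, (Finset.univ.filter fun j => g j = i).card ≤ f := by
    intro i
    have : ((Finset.univ.filter fun j => g j = i).map Fin.valEmbedding) ⊆
        Finset.Ico (i * f) (i * f + f) := by
      intro j hj
      simp only [Finset.mem_map, Finset.mem_filter, Finset.mem_univ, true_and] at hj
      obtain ⟨j, hj, rfl⟩ := hj
      simp only [hg] at hj
      subst hj
      simp only [Fin.valEmbedding_apply, Finset.mem_Ico]
      exact ⟨Nat.div_mul_le_self _ _, Nat.lt_div_mul_add hf⟩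
    simpa using Finset.card_le_card this
  calc ∑ i, matOp (blockMatrix n f) x i ^ 2
      ≤ ∑ i, (f : ℝ) * ∑ j with g j = i, x j ^ 2 := by
        refine Finset.sum_le_sum fun i _ => ?_
        rw [e1]
        refine sq_sum_le_card_mul_sum_sq.trans ?_
        gcongr
        exact_mod_cast hcard i
    _ = f * ∑ j, x j ^ 2 := by
        rw [← Finset.mul_sum, Finset.sum_fiberwise]

/-- Only the first `(n - 1) / f + 1` rows are nonzero, and reading off those coordinates is
injective on `U`. -/
theorem finrank_le_of_blockMatrix_bounded_below {n f : ℕ} {c : ℝ} (hc : 0 < c)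
    (U : Submodule ℝ (EuclideanSpace ℝ (Fin n)))
    (hU : ∀ v ∈ U, c * ‖v‖ ≤ ‖matOp (blockMatrix n f) v‖) :
    Module.finrank ℝ U ≤ (n - 1) / f + 1 := by
  set K := (n - 1) / f + 1 with hK
  let T : U →ₗ[ℝ] (Fin K → ℝ) :=
    { toFun := fun v k => if h : (k : ℕ) < n then matOp (blockMatrix n f) v ⟨k, h⟩ else 0
      map_add' := fun v w => by ext k; simp only [Pi.add_apply]; split_ifs <;> simp
      map_smul' := fun a v => by ext k; simp only [Pi.smul_apply]; split_ifs <;> simp }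
  have hT : Function.Injective T := by
    rw [injective_iff_map_eq_zero]
    intro v hv
    have h0 : matOp (blockMatrix n f) (v : EuclideanSpace ℝ (Fin n)) = 0 := by
      ext i
      by_cases hi : (i : ℕ) < K
      · have := congrFun hv ⟨i, hi⟩
        simpa [T] using this
      · rw [matOp_apply]
        refine Finset.sum_eq_zero fun j _ => ?_
        have : (j : ℕ) / f ≤ (n - 1) / f := Nat.div_le_div_right (by have := j.2; omega)
        rw [blockMatrix, if_neg (by omega), zero_mul]
    have h1 := hU v v.2
    rw [h0, norm_zero] at h1
    have : ‖(v : EuclideanSpace ℝ (Fin n))‖ ≤ 0 := by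
      by_contra! hlt
      exact absurd h1 (not_le.mpr (mul_pos hc hlt))
    simpa using this
  simpa using LinearMap.finrank_le_finrank_of_injective hT

/-- The order `n / l²` of the dimension cannot be improved. -/
theorem exists_matrix_finrank_lt_of_bounded_below (n : ℕ) (l : ℝ) (hl : 1 ≤ l)
    (hln : l ≤ Real.sqrt (n : ℝ)) :
    ∃ A : Matrix (Fin n) (Fin n) ℝ, HasUnitColumns A ∧ ‖matOp A‖ ≤ l ∧
      ∀ (c : ℝ) (U : Submodule ℝ (EuclideanSpace ℝ (Fin n))), 0 < c →
        (∀ v ∈ U, c * ‖v‖ ≤ ‖matOp A v‖) → (Module.finrank ℝ U : ℝ) < 4 * (n : ℝ) / l ^ 2 := by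
  have hl0 : 0 < l := by linarith
  have hl2 : 1 ≤ l ^ 2 := one_le_pow₀ hl
  have hl2n : l ^ 2 ≤ n := by
    rw [Real.le_sqrt hl0.le (by positivity)] at hln
    exact hln
  set f := ⌊l ^ 2⌋₊ with hf
  have hf1 : 1 ≤ f := (Nat.one_le_floor_iff _).mpr hl2
  have hfl : (f : ℝ) ≤ l ^ 2 := Nat.floor_le (by positivity)
  have hlf : l ^ 2 < f + 1 := Nat.lt_floor_add_one _
  have hf1' : (1 : ℝ) ≤ f := by exact_mod_cast hf1
  have hn1 : 1 ≤ n := by exact_mod_cast hl2.trans hl2n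
  refine ⟨blockMatrix n f, hasUnitColumns_blockMatrix n f, ?_, fun c U hc hU => ?_⟩
  · exact (norm_matOp_blockMatrix_le n hf1).trans (Real.sqrt_le_iff.mpr ⟨hl0.le, hfl⟩)
  · have h1 := finrank_le_of_blockMatrix_bounded_below hc U hU
    have h2 : (Module.finrank ℝ U : ℝ) ≤ ((n - 1) / f : ℕ) + 1 := by exact_mod_cast h1
    have h3 : (((n - 1) / f : ℕ) : ℝ) ≤ ((n : ℝ) - 1) / f := by
      refine Nat.cast_div_le.trans ?_
      rw [Nat.cast_sub hn1]
      simp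
    have h4 : ((n : ℝ) - 1) / f * f = n - 1 := by field_simp
    rw [lt_div_iff₀ (by positivity)]
    -- The product is at most `n - 1 + f` with `f ≤ n`; then `l² < f + 1 ≤ 2f` costs the second
    -- factor `2`.
    have h5 : (Module.finrank ℝ U : ℝ) * f < 2 * n := by nlinarith
    nlinarith [(Nat.cast_nonneg (Module.finrank ℝ U) : (0 : ℝ) ≤ _)]

/-! ### Continuous paths of frames -/

section ContinuousFrames

open scoped RealInnerProductSpace

variable {E F : Type*} [NormedAddCommGroup E] [InnerProductSpace ℝ E]
  [NormedAddCommGroup F] [InnerProductSpace ℝ F]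

/-- `J` is isometric and `T` is bounded below by `c` on its range. -/
structure IsLowerBoundFrame (T : E →L[ℝ] E) (c : ℝ) (J : F →L[ℝ] E) : Prop where
  norm_map : ∀ x, ‖J x‖ = ‖x‖
  le_norm : ∀ x, c * ‖x‖ ≤ ‖T (J x)‖

theorem IsLowerBoundFrame.of_norm_sub_le {T T' : E →L[ℝ] E} {c ε : ℝ} {J : F →L[ℝ] E}
    (h : IsLowerBoundFrame T c J) (hT : ‖T' - T‖ ≤ ε) : IsLowerBoundFrame T' (c - ε) J := by
  refine ⟨h.norm_map, fun x => ?_⟩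
  have h1 := h.le_norm x
  have h2 : ‖(T' - T) (J x)‖ ≤ ε * ‖x‖ := by
    rw [← h.norm_map x]
    exact (T' - T).le_of_opNorm_le hT _
  have h3 : ‖T (J x)‖ ≤ ‖T' (J x)‖ + ‖(T' - T) (J x)‖ := by
    rw [sub_apply]
    exact norm_le_norm_add_norm_sub _ _
  linarith

theorem norm_sq_smul_add_smul_of_inner_eq_zero {x y : E} (h : ⟪x, y⟫ = 0) (a b : ℝ) :
    ‖a • x + b • y‖ ^ 2 = a ^ 2 * ‖x‖ ^ 2 + b ^ 2 * ‖y‖ ^ 2 := by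
  rw [norm_add_sq_real, inner_smul_left, inner_smul_right, h, norm_smul, norm_smul, mul_pow,
    mul_pow, Real.norm_eq_abs, Real.norm_eq_abs, sq_abs, sq_abs]
  simp

theorem IsLowerBoundFrame.rotate {T : E →L[ℝ] E} {c : ℝ} (hc : 0 ≤ c) {J J' : F →L[ℝ] E}
    (h : IsLowerBoundFrame T c J) (h' : IsLowerBoundFrame T c J')
    (h1 : ∀ x y, ⟪J x, J' y⟫ = 0) (h2 : ∀ x y, ⟪T (J x), T (J' y)⟫ = 0) (θ : ℝ) :
    IsLowerBoundFrame T c (Real.cos θ • J + Real.sin θ • J') := by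
  have hθ := Real.cos_sq_add_sin_sq θ
  refine ⟨fun x => ?_, fun x => ?_⟩
  · refine (sq_eq_sq₀ (norm_nonneg _) (norm_nonneg _)).mp ?_
    simp only [add_apply, smul_apply]
    rw [norm_sq_smul_add_smul_of_inner_eq_zero (h1 x x), h.norm_map, h'.norm_map, ← add_mul, hθ,
      one_mul]
  · refine (sq_le_sq₀ (by positivity) (norm_nonneg _)).mp ?_
    simp only [add_apply, smul_apply, map_add, map_smul]
    rw [norm_sq_smul_add_smul_of_inner_eq_zero (h2 x x)]
    have e1 : (c * ‖x‖) ^ 2 ≤ ‖T (J x)‖ ^ 2 := by gcongr; exact h.le_norm x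
    have e2 : (c * ‖x‖) ^ 2 ≤ ‖T (J' x)‖ ^ 2 := by gcongr; exact h'.le_norm x
    calc (c * ‖x‖) ^ 2 = Real.cos θ ^ 2 * (c * ‖x‖) ^ 2 + Real.sin θ ^ 2 * (c * ‖x‖) ^ 2 := by
          rw [← add_mul, hθ, one_mul]
      _ ≤ _ := by gcongr

variable (F) in
/-- Every operator `T t` is bounded below by `c` on a subspace of three times the dimension of
`F`. -/
def HasLargeLowerBoundSubspaces (T : ℝ → E →L[ℝ] E) (c : ℝ) : Prop :=
  ∀ t, ∃ V : Submodule ℝ E, 3 * Module.finrank ℝ F ≤ Module.finrank ℝ V ∧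
    ∀ v ∈ V, c * ‖v‖ ≤ ‖T t v‖

variable (F) in
/-- A path of frames that is optimal at `a` can be modified after time `a` so that it is admissible
on `[a, b]` and optimal at `b`. -/
def CanExtendFrames (T : ℝ → E →L[ℝ] E) (c ε a b : ℝ) : Prop :=
  ∀ J : ℝ → F →L[ℝ] E, Continuous J → IsLowerBoundFrame (T a) c (J a) →
    ∃ J' : ℝ → F →L[ℝ] E, Continuous J' ∧ (∀ t ≤ a, J' t = J t) ∧
      IsLowerBoundFrame (T b) c (J' b) ∧
      ∀ t ∈ Set.Icc a b, IsLowerBoundFrame (T t) (c - 2 * ε) (J' t)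

variable {T : ℝ → E →L[ℝ] E} {c ε : ℝ}

theorem CanExtendFrames.refl (hε : 0 ≤ ε) (a : ℝ) : CanExtendFrames F T c ε a a := by
  intro J hJ h
  refine ⟨J, hJ, fun _ _ => rfl, h, fun t ht => ?_⟩
  obtain rfl : t = a := le_antisymm ht.2 ht.1
  exact h.of_norm_sub_le (by simpa using hε)

/-- The full constant `c` is restored at `b`, so the loss stays `2ε`. -/
theorem CanExtendFrames.trans {a b d : ℝ} (hab : a ≤ b) (h1 : CanExtendFrames F T c ε a b)
    (h2 : CanExtendFrames F T c ε b d) : CanExtendFrames F T c ε a d := by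
  intro J hJ h
  obtain ⟨J1, c1, e1, o1, g1⟩ := h1 J hJ h
  obtain ⟨J2, c2, e2, o2, g2⟩ := h2 J1 c1 o1
  refine ⟨J2, c2, fun t ht => (e2 t (ht.trans hab)).trans (e1 t ht), o2, fun t ht => ?_⟩
  rcases le_total t b with htb | htb
  · rw [e2 t htb]
    exact g1 t ⟨ht.1, htb⟩
  · exact g2 t ⟨htb, ht.2⟩

variable [FiniteDimensional ℝ E] [FiniteDimensional ℝ F]

theorem exists_isometry_mem (S : Submodule ℝ E)
    (hS : Module.finrank ℝ F ≤ Module.finrank ℝ S) :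
    ∃ J : F →L[ℝ] E, (∀ x, ‖J x‖ = ‖x‖) ∧ ∀ x, J x ∈ S := by
  let v := stdOrthonormalBasis ℝ F
  let u := stdOrthonormalBasis ℝ S
  let f : F →ₗ[ℝ] S := v.toBasis.constr ℝ fun i => u (Fin.castLE hS i)
  have hf : f ∘ v = fun i => u (Fin.castLE hS i) := by
    ext1 i
    simp [f]
  have hv : Orthonormal ℝ v.toBasis := by simp
  have ho : Orthonormal ℝ (f ∘ v.toBasis) := by
    rw [OrthonormalBasis.coe_toBasis, hf]
    exact u.orthonormal.comp _ (Fin.castLE_injective hS)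
  let g := f.isometryOfOrthonormal hv ho
  exact ⟨S.subtypeL.comp g.toContinuousLinearMap, fun x => g.norm_map x, fun x => (g x).2⟩

theorem exists_isometry_mem_inf_orthogonal (V W : Submodule ℝ E)
    (h : Module.finrank ℝ F + Module.finrank ℝ W ≤ Module.finrank ℝ V) :
    ∃ J : F →L[ℝ] E, (∀ x, ‖J x‖ = ‖x‖) ∧ (∀ x, J x ∈ V) ∧ ∀ x, J x ∈ Wᗮ := by
  have h1 := Submodule.finrank_sup_add_finrank_inf_eq V Wᗮ
  have h2 := W.finrank_add_finrank_orthogonal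
  have h3 := Submodule.finrank_le (V ⊔ Wᗮ)
  obtain ⟨J, hJ, hm⟩ := exists_isometry_mem (F := F) (V ⊓ Wᗮ) (by omega)
  exact ⟨J, hJ, fun x => (hm x).1, fun x => (hm x).2⟩

theorem CanExtendFrames.of_norm_sub_le (hV : HasLargeLowerBoundSubspaces F T c) {a b : ℝ}
    (hab : a < b) (hε : 0 ≤ ε) (hεc : ε ≤ c) (hT : ∀ t ∈ Set.Icc a b, ‖T t - T a‖ ≤ ε) :
    CanExtendFrames F T c ε a b := by
  intro J hJ h
  obtain ⟨V, hV1, hV2⟩ := hV b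
  set R := LinearMap.range (J a : F →ₗ[ℝ] E) with hR
  -- Orthogonality to `T* T J` makes the images under `T a` orthogonal.
  set R' := LinearMap.range
    ((((T a).adjoint.comp (T a)).comp (J a) : F →L[ℝ] E) : F →ₗ[ℝ] E) with hR'
  have hr : Module.finrank ℝ R ≤ Module.finrank ℝ F := LinearMap.finrank_range_le _
  have hr' : Module.finrank ℝ R' ≤ Module.finrank ℝ F := LinearMap.finrank_range_le _
  have hs : Module.finrank ℝ ↥(R ⊔ R') ≤ Module.finrank ℝ R + Module.finrank ℝ R' :=
    Submodule.finrank_add_le_finrank_add_finrank _ _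
  obtain ⟨K, hK1, hK2, hK3⟩ := exists_isometry_mem_inf_orthogonal (F := F) V (R ⊔ R') (by omega)
  have hKb : IsLowerBoundFrame (T b) c K := ⟨hK1, fun x => by
    rw [← hK1 x]
    exact hV2 _ (hK2 x)⟩
  have hKa : IsLowerBoundFrame (T a) (c - ε) K := hKb.of_norm_sub_le (by
    rw [norm_sub_rev]
    exact hT b ⟨hab.le, le_rfl⟩)
  have hJa : IsLowerBoundFrame (T a) (c - ε) (J a) := h.of_norm_sub_le (by simpa using hε)
  have ho1 : ∀ x y, ⟪J a x, K y⟫ = 0 := fun x y =>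
    (Submodule.mem_orthogonal _ _).mp (hK3 y) _ (Submodule.mem_sup_left ⟨x, rfl⟩)
  have ho2 : ∀ x y, ⟪T a (J a x), T a (K y)⟫ = 0 := fun x y => by
    rw [← ContinuousLinearMap.adjoint_inner_left]
    exact (Submodule.mem_orthogonal _ _).mp (hK3 y) _ (Submodule.mem_sup_right ⟨x, rfl⟩)
  have hrot := hJa.rotate (sub_nonneg.mpr hεc) hKa ho1 ho2
  let θ : ℝ → ℝ := fun t => Real.pi / 2 * max 0 (min 1 ((t - a) / (b - a)))
  have hθc : Continuous θ := by fun_prop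
  have hba : 0 < b - a := sub_pos.mpr hab
  -- The old path is frozen after `a`, and the clamped angle turns it into `K` over `[a, b]`.
  refine ⟨fun t => Real.cos (θ t) • J (min t a) + Real.sin (θ t) • K, by fun_prop, fun t ht => ?_,
    ?_, fun t ht => ?_⟩
  · have h0 : θ t = 0 := by
      have : (t - a) / (b - a) ≤ 0 := div_nonpos_of_nonpos_of_nonneg (by linarith) hba.le
      simp [θ, this.trans zero_le_one, this]
    simp [h0, ht]
  · have h0 : θ b = Real.pi / 2 := by simp [θ, hba.ne']
    simpa [h0] using hKb
  · simp only [min_eq_right ht.1]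
    have := (hrot (θ t)).of_norm_sub_le (hT t ht)
    rwa [sub_sub, ← two_mul] at this

theorem CanExtendFrames.of_continuous (hV : HasLargeLowerBoundSubspaces F T c) (hT : Continuous T)
    (hε : 0 < ε) (hεc : ε ≤ c) (a : ℝ) : CanExtendFrames F T c ε a (a + 1) := by
  have hu := isCompact_Icc.uniformContinuousOn_of_continuous (s := Set.Icc a (a + 1))
    hT.continuousOn
  rw [Metric.uniformContinuousOn_iff] at hu
  obtain ⟨δ, hδ, hu⟩ := hu ε hε
  obtain ⟨N, hN⟩ := exists_nat_one_div_lt hδ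
  set r : ℝ := 1 / ((N : ℝ) + 1) with hr
  have hr0 : 0 < r := by positivity
  have hNr : ((N : ℝ) + 1) * r = 1 := by rw [hr]; field_simp
  have key : ∀ i : ℕ, i ≤ N + 1 → CanExtendFrames F T c ε a (a + i * r) := by
    intro i
    induction i with
    | zero => intro _; simpa using CanExtendFrames.refl hε.le a
    | succ i ih =>
      intro hi
      have hi' : ((i : ℝ) + 1) * r ≤ 1 := by
        refine le_trans (mul_le_mul_of_nonneg_right ?_ hr0.le) hNr.le
        exact_mod_cast hi
      have hir : 0 ≤ i * r := by positivity
      refine (ih (by omega)).trans (by linarith) (.of_norm_sub_le hV ?_ hε.le hεc ?_)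
      · push_cast
        linarith
      · intro t ht
        have ht2 := ht.2
        push_cast at ht2
        rw [← dist_eq_norm]
        refine (hu t ⟨by linarith [ht.1], by linarith⟩ _ ⟨by linarith, by linarith⟩ ?_).le
        rw [Real.dist_eq, abs_of_nonneg (by linarith [ht.1])]
        linarith
  have := key (N + 1) le_rfl
  push_cast at this
  rwa [hNr] at this

/-- Frames on the half-line with a prescribed optimal initial frame. -/
theorem exists_continuous_frames_half_line (hV : HasLargeLowerBoundSubspaces F T c)
    (hT : Continuous T) (hε : 0 < ε) (hεc : ε ≤ c) {J₀ : F →L[ℝ] E}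
    (hJ₀ : IsLowerBoundFrame (T 0) c J₀) :
    ∃ J : ℝ → F →L[ℝ] E, Continuous J ∧ J 0 = J₀ ∧
      ∀ t, 0 ≤ t → IsLowerBoundFrame (T t) (c - 2 * ε) (J t) := by
  let X (k : ℕ) := {J : ℝ → F →L[ℝ] E // Continuous J ∧ IsLowerBoundFrame (T k) c (J k)}
  have hX : ∀ (k : ℕ) (J : X k), ∃ J' : X (k + 1), (∀ t ≤ (k : ℝ), J'.1 t = J.1 t) ∧
      ∀ t ∈ Set.Icc (k : ℝ) (k + 1), IsLowerBoundFrame (T t) (c - 2 * ε) (J'.1 t) := by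
    intro k J
    obtain ⟨J', c1, e1, o1, g1⟩ :=
      CanExtendFrames.of_continuous hV hT hε hεc (k : ℝ) J.1 J.2.1 J.2.2
    exact ⟨⟨J', c1, by push_cast; exact o1⟩, e1, g1⟩
  choose next hnext1 hnext2 using hX
  let S : ∀ k : ℕ, X k := fun k =>
    Nat.rec (motive := X) ⟨fun _ => J₀, continuous_const, by simpa using hJ₀⟩ next k
  have hS : ∀ k : ℕ, ∀ j ≥ k, ∀ t ≤ (k : ℝ), (S j).1 t = (S k).1 t := by
    intro k j hj t ht
    induction j, hj using Nat.le_induction with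
    | base => rfl
    | succ j hj ih =>
      rw [← ih]
      exact hnext1 j (S j) t (ht.trans (by exact_mod_cast hj))
  -- The paths stabilise: later stages do not change values up to time `k`, so the limit is locally
  -- one of the `S k`.
  have hJ : ∀ (k : ℕ) (t : ℝ), t ≤ k → (S ⌈t⌉₊).1 t = (S k).1 t := fun k t ht =>
    (hS ⌈t⌉₊ k (Nat.ceil_le.mpr ht) t (Nat.le_ceil t)).symm
  refine ⟨fun t => (S ⌈t⌉₊).1 t, continuous_iff_continuousAt.mpr fun t => ?_, ?_, fun t ht => ?_⟩
  · obtain ⟨k, hk⟩ := exists_nat_gt t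
    refine ((S k).2.1.continuousAt (x := t)).congr ?_
    filter_upwards [Iio_mem_nhds hk] with s hs
    exact (hJ k s (le_of_lt hs)).symm
  · change (S ⌈(0 : ℝ)⌉₊).1 0 = J₀
    rw [hJ 0 0 (by simp)]
    rfl
  · have h1 := Nat.floor_le ht
    have h2 := Nat.lt_floor_add_one t
    have := hnext2 ⌊t⌋₊ (S ⌊t⌋₊) t ⟨h1, h2.le⟩
    change IsLowerBoundFrame (T t) (c - 2 * ε) ((S ⌈t⌉₊).1 t)
    rw [hJ (⌊t⌋₊ + 1) t (by push_cast; exact h2.le)]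
    exact this

theorem exists_continuous_frames (hV : HasLargeLowerBoundSubspaces F T c)
    (hT : Continuous T) (hε : 0 < ε) (hεc : ε ≤ c) :
    ∃ J : ℝ → F →L[ℝ] E, Continuous J ∧
      ∀ t, IsLowerBoundFrame (T t) (c - 2 * ε) (J t) := by
  obtain ⟨V, hV1, hV2⟩ := hV 0
  obtain ⟨J₀, hJ1, hJ2⟩ := exists_isometry_mem (F := F) V (by omega)
  have hJ₀ : IsLowerBoundFrame (T 0) c J₀ := ⟨hJ1, fun x => by
    rw [← hJ1 x]
    exact hV2 _ (hJ2 x)⟩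
  obtain ⟨P, hP, hP0, hPt⟩ := exists_continuous_frames_half_line hV hT hε hεc hJ₀
  obtain ⟨Q, hQ, hQ0, hQt⟩ := exists_continuous_frames_half_line (T := fun t => T (-t))
    (fun t => hV (-t)) (by fun_prop) hε hεc (by simpa using hJ₀)
  -- On each half-line the other path is constantly `J₀` and cancels.
  refine ⟨fun t => P (max t 0) + Q (max (-t) 0) - J₀, by fun_prop, fun t => ?_⟩
  rcases le_total 0 t with ht | ht
  · simpa [ht, hQ0] using hPt t ht
  · simpa [ht, hP0] using hQt (-t) (by linarith)

theorem starProjection_range_of_norm_map {J : F →L[ℝ] E} (hJ : ∀ x, ‖J x‖ = ‖x‖) :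
    (LinearMap.range (J : F →ₗ[ℝ] E)).starProjection = J.comp J.adjoint := by
  ext v
  refine Submodule.eq_starProjection_of_mem_of_inner_eq_zero ⟨J.adjoint v, rfl⟩ ?_
  rintro _ ⟨x, rfl⟩
  have hi : ∀ x y, ⟪J x, J y⟫ = ⟪x, y⟫ :=
    (LinearMap.norm_map_iff_inner_map_map J).mp hJ
  rw [inner_sub_left]
  change ⟪v, J x⟫ - ⟪J (J.adjoint v), J x⟫ = 0
  rw [hi, ContinuousLinearMap.adjoint_inner_left, sub_self]

end ContinuousFrames

/-! ### From frames to subspaces of Euclidean space -/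

theorem isContinuousFamily_const {n : ℕ} (U : Submodule ℝ (EuclideanSpace ℝ (Fin n))) :
    IsContinuousFamily fun _ => U := by
  exact continuous_const (y := U.starProjection)

theorem continuous_matOp {n : ℕ} {A : ℝ → Matrix (Fin n) (Fin n) ℝ} (hA : Continuous A) :
    Continuous fun t => matOp (A t) :=
  (LinearMap.continuous_of_finiteDimensional
    (Matrix.toEuclideanCLM (n := Fin n) (𝕜 := ℝ)).toAlgEquiv.toLinearMap).comp hA

theorem exists_subspace_of_isBourgainTzafririPair {c d : ℝ} (h : IsBourgainTzafririPair c d)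
    {n : ℕ} {A : Matrix (Fin n) (Fin n) ℝ} (hA : HasUnitColumns A) :
    ∃ V : Submodule ℝ (EuclideanSpace ℝ (Fin n)),
      d * (n : ℝ) / ‖matOp A‖ ^ 2 ≤ (Module.finrank ℝ V : ℝ) ∧
      ∀ v ∈ V, c * ‖v‖ ≤ ‖matOp A v‖ := by
  obtain ⟨σ, hσ, hb⟩ := h.2.2 n A hA
  let e : Fin n → EuclideanSpace ℝ (Fin n) := fun i => EuclideanSpace.single i (1 : ℝ)
  have he : Orthonormal ℝ e := EuclideanSpace.orthonormal_single
  refine ⟨Submodule.span ℝ (e '' σ), ?_, fun v hv => ?_⟩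
  · have hli : LinearIndependent ℝ fun i : σ => e i :=
      he.linearIndependent.comp _ Subtype.val_injective
    have h1 := finrank_span_eq_card hli
    have h2 : Set.range (fun i : σ => e i) = e '' σ := by ext; simp
    rw [h2, Fintype.card_coe] at h1
    rwa [h1]
  · obtain ⟨a, rfl⟩ := (Submodule.mem_span_image_finset_iff_exists_fun' ℝ).mp hv
    have h1 : ‖∑ i ∈ σ, a i • e i‖ = Real.sqrt (∑ j ∈ σ, |a j| ^ 2) := by
      rw [← Real.sqrt_sq (norm_nonneg _), ← real_inner_self_eq_norm_sq, he.inner_sum]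
      simp [sq]
    rw [h1, map_sum]
    simpa using hb a

/-- Test on the `1 × 1` identity, where `d > 0` forces a nonzero subspace. -/
theorem IsBourgainTzafririPair.le_one {c d : ℝ} (h : IsBourgainTzafririPair c d) : c ≤ 1 := by
  have hu : HasUnitColumns (1 : Matrix (Fin 1) (Fin 1) ℝ) := fun i => by simp
  obtain ⟨V, hV1, hV2⟩ := exists_subspace_of_isBourgainTzafririPair h hu
  have hpos : (0 : ℝ) < Module.finrank ℝ V := lt_of_lt_of_le (by simpa using h.2.1) hV1
  have : Nontrivial V := Module.nontrivial_of_finrank_pos (R := ℝ) (by exact_mod_cast hpos)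
  obtain ⟨v, hv⟩ := exists_ne (0 : V)
  have h1 := hV2 v v.2
  have h2 : 0 < ‖(v : EuclideanSpace ℝ (Fin 1))‖ := by simpa using hv
  simp only [map_one, one_apply_eq_self] at h1
  exact le_of_mul_le_mul_right (by simpa using h1) h2

theorem exists_continuousFamily_bounded_below {c d : ℝ} (h : IsBourgainTzafririPair c d) {n : ℕ}
    {A : ℝ → Matrix (Fin n) (Fin n) ℝ} (hA : Continuous A) (hu : ∀ t, HasUnitColumns (A t))
    {L : ℝ} (hL : ∀ t, ‖matOp (A t)‖ ≤ L) {γ : ℝ} (hγ : 0 < γ) (hγ1 : γ < 1) :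
    ∃ (m : ℕ) (U : ℝ → Submodule ℝ (EuclideanSpace ℝ (Fin n))),
      d * (n : ℝ) / (7 * L ^ 2) ≤ (m : ℝ) ∧ IsContinuousFamily U ∧
      (∀ t, Module.finrank ℝ (U t) = m) ∧ ∀ t, ∀ v ∈ U t, γ * c * ‖v‖ ≤ ‖matOp (A t) v‖ := by
  rcases Nat.eq_zero_or_pos n with rfl | hn
  · exact ⟨0, fun _ => ⊥, by simp, isContinuousFamily_const ⊥, fun _ => by simp, fun t v _ => by
      simp [Subsingleton.elim v 0]⟩
  have hc := h.1
  have hd := h.2.1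
  have hL1 : 1 ≤ L := (one_le_norm_matOp hn (hu 0)).trans (hL 0)
  have hL0 : 0 < L := by linarith
  set x := d * (n : ℝ) / L ^ 2 with hx
  have hx7 : d * (n : ℝ) / (7 * L ^ 2) = x / 7 := by rw [hx]; field_simp
  rw [hx7]
  -- For `x ≤ 7` a fixed coordinate line is enough. Otherwise `m = ⌈x⌉₊ / 3` satisfies `m ≥ (x - 2)
  -- / 3 ≥ x / 7`.
  rcases le_or_gt x 7 with hle | hgt
  · set e : EuclideanSpace ℝ (Fin n) := EuclideanSpace.single ⟨0, hn⟩ (1 : ℝ) with he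
    refine ⟨1, fun _ => Submodule.span ℝ {e}, ?_, isContinuousFamily_const _,
      fun _ => finrank_span_singleton (by simp [he]), fun t v hv => ?_⟩
    · push_cast
      linarith
    · obtain ⟨a, rfl⟩ := Submodule.mem_span_singleton.mp hv
      have h1 : ‖e‖ = 1 := by simp [he]
      have h2 : γ * c ≤ 1 := mul_le_one₀ hγ1.le hc.le h.le_one
      rw [map_smul, norm_smul, norm_smul, he, hu t, ← he, h1]
      simpa using mul_le_mul_of_nonneg_right h2 (abs_nonneg a)
  · set m := ⌈x⌉₊ / 3 with hm
    have hV : HasLargeLowerBoundSubspaces (EuclideanSpace ℝ (Fin m)) (fun t => matOp (A t)) c := by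
      intro t
      obtain ⟨V, hV1, hV2⟩ := exists_subspace_of_isBourgainTzafririPair h (hu t)
      refine ⟨V, ?_, hV2⟩
      have h1 : x ≤ Module.finrank ℝ V := by
        refine le_trans ?_ hV1
        have := one_le_norm_matOp hn (hu t)
        rw [hx]
        gcongr
        exact hL t
      have h2 : ⌈x⌉₊ ≤ Module.finrank ℝ V := Nat.ceil_le.mpr h1
      rw [finrank_euclideanSpace_fin]
      omega
    obtain ⟨J, hJ, hJt⟩ := exists_continuous_frames (ε := (1 - γ) * c / 2) hV (continuous_matOp hA)
      (by have := mul_pos (sub_pos.mpr hγ1) hc; linarith) (by nlinarith)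
    refine ⟨m, fun t => LinearMap.range (J t : EuclideanSpace ℝ (Fin m) →ₗ[ℝ] _), ?_, ?_,
      fun t => ?_, ?_⟩
    · have h1 : ⌈x⌉₊ ≤ 3 * m + 2 := by omega
      have h2 : (⌈x⌉₊ : ℝ) ≤ 3 * m + 2 := by exact_mod_cast h1
      have h3 := Nat.le_ceil x
      linarith
    · unfold IsContinuousFamily
      simp only [fun t => starProjection_range_of_norm_map (hJt t).norm_map]
      exact hJ.clm_comp (ContinuousLinearMap.adjoint.continuous.comp hJ)
    · rw [LinearMap.finrank_range_of_inj, finrank_euclideanSpace_fin]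
      exact (AddMonoidHomClass.isometry_of_norm (J t) (hJt t).norm_map).injective
    · rintro t _ ⟨y, rfl⟩
      have h1 := (hJt t).le_norm y
      rw [← (hJt t).norm_map y] at h1
      refine le_trans (le_of_eq ?_) h1
      simp only [ContinuousLinearMap.coe_coe]
      ring

theorem theorem1p4 :
    -- Bourgain–Tzafriri constants exist
    (∃ c₀ d₀ : ℝ, IsBourgainTzafririPair c₀ d₀) ∧
    -- the continuous restricted invertibility theorem, for any such constants
    (∀ c₀ d₀ : ℝ, IsBourgainTzafririPair c₀ d₀ →
      ∀ (n : ℕ) (A : ℝ → Matrix (Fin n) (Fin n) ℝ), Continuous A →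
        (∀ t : ℝ, HasUnitColumns (A t)) →
        ∀ Λ : ℝ, IsLUB (Set.range fun t : ℝ => ‖matOp (A t)‖) Λ →
        ∀ γ : ℝ, 0 < γ → γ < 1 →
          ∃ (m : ℕ) (U : ℝ → Submodule ℝ (EuclideanSpace ℝ (Fin n))),
            d₀ * (n : ℝ) / (7 * Λ ^ 2) ≤ (m : ℝ) ∧
            IsContinuousFamily U ∧
            (∀ t : ℝ, Module.finrank ℝ (U t) = m) ∧
            ∀ t : ℝ, ∀ v ∈ U t, γ * c₀ * ‖v‖ ≤ ‖matOp (A t) v‖) ∧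
    -- optimality, up to a constant, of the order `n / Λ²` of the dimension
    (∀ (n : ℕ) (l : ℝ), 1 ≤ l → l ≤ Real.sqrt (n : ℝ) →
      ∃ A : ℝ → Matrix (Fin n) (Fin n) ℝ, Continuous A ∧
        (∀ t : ℝ, HasUnitColumns (A t)) ∧
        (∀ t : ℝ, ‖matOp (A t)‖ ≤ l) ∧
        ∀ (c : ℝ) (m : ℕ) (U : ℝ → Submodule ℝ (EuclideanSpace ℝ (Fin n))),
          0 < c → IsContinuousFamily U →
          (∀ t : ℝ, Module.finrank ℝ (U t) = m) →
          (∀ t : ℝ, ∀ v ∈ U t, c * ‖v‖ ≤ ‖matOp (A t) v‖) →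
          (m : ℝ) < 4 * (n : ℝ) / l ^ 2) := by 
  refine ⟨⟨_, _, exists_isBourgainTzafririPair⟩, ?_, ?_⟩
  · intro c₀ d₀ h n A hA hu Λ hΛ γ hγ hγ1
    exact exists_continuousFamily_bounded_below h hA hu (fun t => hΛ.1 ⟨t, rfl⟩) hγ hγ1
  · intro n l hl hln
    obtain ⟨A, hu, hA, hU⟩ := exists_matrix_finrank_lt_of_bounded_below n l hl hln
    refine ⟨fun _ => A, continuous_const, fun _ => hu, fun _ => hA, ?_⟩
    intro c m U hc _ hm hb
    rw [← hm 0]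
    exact hU c (U 0) hc (hb 0)
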